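/- Let $k$ be a field, $H$ a Hopf algebra over $k$ with antipode $S$, and $C$ a right $H$-module coalgebra (a coalgebra and right $H$-module with $\Delta(ch)=c_1h_1\otimes c_2h_2$ and $\varepsilon(ch)=\varepsilon(c)\varepsilon(h)$). Let $I=\operatorname{span}\{ch-\varepsilon(h)c : c\in C,\ h\in H\}$, a two-sided coideal, $D=C/I$ the quotient coalgebra and $\pi\colon C\to D$ the projection. Let $C\,\square_D\,C\subseteq C\otimes C$ be the cotensor product, i.e. the subspace on which the maps $c\otimes c'\mapsto c_1\otimes\pi(c_2)\otimes c'$ and $c\otimes c'\mapsto c\otimes\pi(c'_1)\otimes c'_2$ agree. Assume that $C(D)_H$ is a Hopf Galois coextension, i.e. that the canonical map $$can\colon C\otimes H\to C\,\square_D\,C,\qquad c\otimes h\mapsto c_1\otimes c_2h,$$ is bijective, and that it is cleft by the total cointegral $f$: $f\colon C\to H$ is a linear map with $\varepsilon(f(c))=\varepsilon(c)$ and $f(ch)=f(c)h$, and $f$ has a two-sided inverse $f^{-1}\colon C\to H$ for the convolution product, i.e. $f(c_1)f^{-1}(c_2)=\varepsilon(c)1_H=f^{-1}(c_1)f(c_2)$.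 Put $$C^D=\{c\in C : c_1\,\varphi(\pi(c_2))=c_2\,\varphi(\pi(c_1))\ \text{ for all }\varphi\in D^*\},$$ where $D^*$ is the algebraic dual of $D$. Then $C^D$ is an $H$-submodule of $C$, the formula $$\rho(c)=f^{-1}(c_3)\,f(c_1)\otimes c_2$$ defines a linear map $\rho\colon C^D\to H\otimes C^D$, and with the restricted action and the coaction $\rho$ the space $C^D$ is a right-left stable anti-Yetter–Drinfeld module over $H$. That is, writing $\rho(m)=m_{(-1)}\otimes m_{(0)}$: $\rho$ is a coassociative and counital left coaction, $\rho(mh)=S(h_3)\,m_{(-1)}\,h_1\otimes m_{(0)}h_2$, and $m_{(0)}m_{(-1)}=m$, for all $m\in C^D$ and $h\in H$. -/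

import Mathlib

open scoped TensorProduct RightActions

namespace HopfCoextension

section Action

variable (k H M : Type*) [Field k] [Ring H] [HopfAlgebra k H] [AddCommGroup M] [Module k M]
  [Module Hᵐᵒᵖ M] [IsScalarTower k Hᵐᵒᵖ M]

/-- A right `H`-module over `k` is a module over the opposite algebra of `H` whose scalars are
compatible with those of `k`; this is its action map `M ⊗ H → M`, `m ⊗ h ↦ m h`. -/
noncomputable def rightAct : M ⊗[k] H →ₗ[k] M :=
  TensorProduct.lift <| LinearMap.mk₂ k (fun (m : M) (h : H) => m <• h)
    (fun m n h => smul_add _ m n)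
    (fun r m h => smul_comm (MulOpposite.op h) r m)
    (fun m h h' => by rw [MulOpposite.op_add, add_smul])
    (fun r m h => by rw [MulOpposite.op_smul, smul_assoc])

@[simp] lemma rightAct_tmul (m : M) (h : H) : rightAct k H M (m ⊗ₜ h) = m <• h := rfl

/-- The map `H ⊗ (H ⊗ H) → H`, `a ⊗ (x ⊗ z) ↦ S(z) a x`, where `S` is the antipode. -/
noncomputable def antipodeSandwich : H ⊗[k] (H ⊗[k] H) →ₗ[k] H :=
  LinearMap.mul' k H
    ∘ₗ TensorProduct.map (HopfAlgebra.antipode k) (LinearMap.mul' k H)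
    ∘ₗ (TensorProduct.comm k (H ⊗[k] H) H).toLinearMap
    ∘ₗ (TensorProduct.assoc k H H H).symm.toLinearMap

@[simp] lemma antipodeSandwich_tmul (a x z : H) :
    antipodeSandwich k H (a ⊗ₜ (x ⊗ₜ z)) = HopfAlgebra.antipode k z * (a * x) := rfl

/-- The map `(H ⊗ M) ⊗ (H ⊗ (H ⊗ H)) → H ⊗ M`,
`(a ⊗ m) ⊗ (x ⊗ (y ⊗ z)) ↦ S(z) a x ⊗ m y`. -/
noncomputable def aydTwist : (H ⊗[k] M) ⊗[k] (H ⊗[k] (H ⊗[k] H)) →ₗ[k] H ⊗[k] M :=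
  TensorProduct.map (antipodeSandwich k H) (rightAct k H M)
    ∘ₗ (TensorProduct.tensorTensorTensorComm k H M (H ⊗[k] H) H).toLinearMap
    ∘ₗ LinearMap.lTensor (H ⊗[k] M)
        ((TensorProduct.rightComm k H H H).toLinearMap
          ∘ₗ (TensorProduct.assoc k H H H).symm.toLinearMap)

@[simp] lemma aydTwist_tmul (a x y z : H) (m : M) :
    aydTwist k H M ((a ⊗ₜ m) ⊗ₜ (x ⊗ₜ (y ⊗ₜ z))) =
      (HopfAlgebra.antipode k z * (a * x)) ⊗ₜ (m <• y) := rfl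

variable {k H M}

/-- `ρ : M → H ⊗ M`, written `ρ m = m₍₋₁₎ ⊗ m₍₀₎`, makes the right `H`-module `M` a right-left
stable anti-Yetter-Drinfeld module over `H`. -/
structure IsRightLeftSAYD (ρ : M →ₗ[k] H ⊗[k] M) : Prop where
  /-- `ρ` is coassociative. -/
  coassoc : (TensorProduct.assoc k H H M).toLinearMap ∘ₗ LinearMap.rTensor M Coalgebra.comul ∘ₗ ρ
    = LinearMap.lTensor H ρ ∘ₗ ρ
  /-- `ρ` is counital: `ε(m₍₋₁₎) m₍₀₎ = m`. -/
  counit_coact : ∀ m : M,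
    TensorProduct.lid k M (LinearMap.rTensor M Coalgebra.counit (ρ m)) = m
  /-- `ρ (m h) = S(h₃) m₍₋₁₎ h₁ ⊗ m₍₀₎ h₂`. -/
  antiYetterDrinfeld : ∀ (m : M) (h : H), ρ (m <• h) =
    aydTwist k H M (ρ m ⊗ₜ LinearMap.lTensor H Coalgebra.comul (Coalgebra.comul (R := k) h))
  /-- `m₍₀₎ m₍₋₁₎ = m`. -/
  stable : ∀ m : M, rightAct k H M (TensorProduct.comm k H M (ρ m)) = m

end Action

section Coextension

variable (k H C : Type*) [Field k] [Ring H] [HopfAlgebra k H] [AddCommGroup C] [Module k C]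
  [Coalgebra k C] [Module Hᵐᵒᵖ C] [IsScalarTower k Hᵐᵒᵖ C]

/-- The coalgebra and right `H`-module `C` is a right `H`-module coalgebra:
`Δ(c h) = c₁ h₁ ⊗ c₂ h₂` and `ε(c h) = ε(c) ε(h)`. -/
class IsModuleCoalgebra : Prop where
  comul_act : ∀ (c : C) (h : H), Coalgebra.comul (R := k) (c <• h) =
    TensorProduct.map (rightAct k H C) (rightAct k H C)
      (TensorProduct.tensorTensorTensorComm k C C H H
        (Coalgebra.comul (R := k) c ⊗ₜ Coalgebra.comul (R := k) h))
  counit_act : ∀ (c : C) (h : H), Coalgebra.counit (R := k) (c <• h) =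
    Coalgebra.counit (R := k) c * Coalgebra.counit (R := k) h

/-- The coideal `I = span {c h - ε(h) c}` of `C`. -/
def coideal : Submodule k C :=
  Submodule.span k {x | ∃ (c : C) (h : H), x = c <• h - Coalgebra.counit (R := k) h • c}

/-- The quotient `D = C / I`. -/
abbrev base : Type _ := C ⧸ coideal k H C

/-- The projection `π : C → D`. -/
abbrev proj : C →ₗ[k] base k H C := (coideal k H C).mkQ

lemma proj_act (c : C) (h : H) :
    proj k H C (c <• h) = Coalgebra.counit (R := k) h • proj k H C c := by
  rw [← map_smul, ← sub_eq_zero, ← map_sub]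
  exact (Submodule.Quotient.mk_eq_zero _).2 (Submodule.subset_span ⟨c, h, rfl⟩)

lemma proj_comp_rightAct : proj k H C ∘ₗ rightAct k H C =
    (TensorProduct.rid k (base k H C)).toLinearMap
      ∘ₗ TensorProduct.map (proj k H C) Coalgebra.counit := by
  ext c h
  simp [-Submodule.mkQ_apply, proj_act]

/-- `I` is a two-sided coideal, so `D` is a coalgebra and `π` a map of coalgebras. -/
instance [IsModuleCoalgebra k H C] : (coideal k H C).IsCoideal where
  counit_eq_zero := by
    intro x hx
    induction hx using Submodule.span_induction with
    | mem x h =>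
      obtain ⟨c, h, rfl⟩ := h
      simp [IsModuleCoalgebra.counit_act, mul_comm]
    | zero => simp
    | add x y _ _ hx hy => simp [hx, hy]
    | smul a x _ hx => simp [hx]
  map_mkQ_comul_eq_zero := by
    intro x hx
    induction hx using Submodule.span_induction with
    | mem x h =>
      obtain ⟨c, h, rfl⟩ := h
      rw [map_sub, IsModuleCoalgebra.comul_act, map_smul, map_sub, map_smul, sub_eq_zero]
      rw [← LinearMap.comp_apply, ← TensorProduct.map_comp, proj_comp_rightAct]
      have key : ∀ (u : C ⊗[k] C) (v : H ⊗[k] H),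
          TensorProduct.map
            ((TensorProduct.rid k (base k H C)).toLinearMap
              ∘ₗ TensorProduct.map (proj k H C) Coalgebra.counit)
            ((TensorProduct.rid k (base k H C)).toLinearMap
              ∘ₗ TensorProduct.map (proj k H C) Coalgebra.counit)
            (TensorProduct.tensorTensorTensorComm k C C H H (u ⊗ₜ v)) =
          (Coalgebra.counit (R := k)
            (TensorProduct.lid k H (LinearMap.rTensor H Coalgebra.counit v))) •
            TensorProduct.map (proj k H C) (proj k H C) u := by
        intro u v
        induction u with
        | zero => simp
        | add a b ha hb => rw [TensorProduct.add_tmul, map_add, map_add, ha, hb, map_add, smul_add]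
        | tmul a b =>
          induction v with
          | zero => simp
          | add x y hx hy =>
            rw [TensorProduct.tmul_add, map_add, map_add, hx, hy]
            simp only [map_add, add_smul]
          | tmul x y =>
            simp [TensorProduct.smul_tmul', TensorProduct.tmul_smul, smul_smul, mul_comm]
      rw [key]
      simp
    | zero => simp
    | add x y _ _ hx hy => simp only [map_add, hx, hy, add_zero]
    | smul a x _ hx => simp only [map_smul, hx, smul_zero]

/-- The cotensor product `C □_D C`: the tensors on which `c ⊗ c' ↦ c₁ ⊗ π(c₂) ⊗ c'` and
`c ⊗ c' ↦ c ⊗ π(c'₁) ⊗ c'₂` agree. -/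
noncomputable def cotensor : Submodule k (C ⊗[k] C) :=
  LinearMap.eqLocus
    ((TensorProduct.assoc k C (base k H C) C).toLinearMap
      ∘ₗ LinearMap.rTensor C (LinearMap.lTensor C (proj k H C) ∘ₗ Coalgebra.comul))
    (LinearMap.lTensor C (LinearMap.rTensor C (proj k H C) ∘ₗ Coalgebra.comul))

/-- The map `C ⊗ H → C ⊗ C`, `c ⊗ h ↦ c₁ ⊗ c₂ h`. -/
noncomputable def canAux : C ⊗[k] H →ₗ[k] C ⊗[k] C :=
  LinearMap.lTensor C (rightAct k H C)
    ∘ₗ (TensorProduct.assoc k C C H).toLinearMap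
    ∘ₗ LinearMap.rTensor H Coalgebra.comul

lemma canAux_mem [IsModuleCoalgebra k H C] (x : C ⊗[k] H) :
    canAux k H C x ∈ cotensor k H C := by
  have h1 : ∀ (c : C) (h : H),
      LinearMap.rTensor C (proj k H C) (Coalgebra.comul (R := k) (c <• h)) =
      LinearMap.lTensor (base k H C) (rightAct k H C)
        (TensorProduct.assoc k (base k H C) C H
          (LinearMap.rTensor C (proj k H C) (Coalgebra.comul (R := k) c) ⊗ₜ h)) := by
    intro c h
    have key : ∀ (u : C ⊗[k] C) (v : H ⊗[k] H),
        LinearMap.rTensor C (proj k H C)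
          (TensorProduct.map (rightAct k H C) (rightAct k H C)
            (TensorProduct.tensorTensorTensorComm k C C H H (u ⊗ₜ v))) =
        LinearMap.lTensor (base k H C) (rightAct k H C)
          (TensorProduct.assoc k (base k H C) C H
            (LinearMap.rTensor C (proj k H C) u ⊗ₜ
              TensorProduct.lid k H (LinearMap.rTensor H Coalgebra.counit v))) := by
      intro u v
      induction u with
      | zero => simp
      | add a b ha hb => simp only [TensorProduct.add_tmul, map_add, ha, hb]
      | tmul a b =>
        induction v with
        | zero => simp
        | add x y hx hy => simp only [TensorProduct.tmul_add, map_add, hx, hy]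
        | tmul x y =>
          simp [-Submodule.mkQ_apply, proj_act, TensorProduct.smul_tmul', TensorProduct.tmul_smul]
    rw [IsModuleCoalgebra.comul_act, key]
    simp
  have h2 : ∀ (u : C ⊗[k] C) (h : H),
      TensorProduct.assoc k C (base k H C) C
        (LinearMap.rTensor C (LinearMap.lTensor C (proj k H C) ∘ₗ Coalgebra.comul)
          (LinearMap.lTensor C (rightAct k H C) (TensorProduct.assoc k C C H (u ⊗ₜ h)))) =
      LinearMap.lTensor C (LinearMap.lTensor (base k H C) (rightAct k H C)
          ∘ₗ (TensorProduct.assoc k (base k H C) C H).toLinearMap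
          ∘ₗ (TensorProduct.mk k (base k H C ⊗[k] C) H).flip h
          ∘ₗ LinearMap.rTensor C (proj k H C))
        (TensorProduct.assoc k C C C (LinearMap.rTensor C Coalgebra.comul u)) := by
    intro u h
    induction u with
    | zero => simp
    | add a b ha hb => simp only [TensorProduct.add_tmul, map_add, ha, hb]
    | tmul a b =>
      simp only [TensorProduct.assoc_tmul, LinearMap.lTensor_tmul, rightAct_tmul,
        LinearMap.rTensor_tmul, LinearMap.comp_apply]
      induction (Coalgebra.comul (R := k) a) with
      | zero => simp
      | add x y hx hy => simp only [TensorProduct.add_tmul, map_add, hx, hy]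
      | tmul x y => simp
  have h3 : ∀ (u : C ⊗[k] C) (h : H),
      LinearMap.lTensor C (LinearMap.rTensor C (proj k H C) ∘ₗ Coalgebra.comul)
          (LinearMap.lTensor C (rightAct k H C) (TensorProduct.assoc k C C H (u ⊗ₜ h))) =
      LinearMap.lTensor C (LinearMap.lTensor (base k H C) (rightAct k H C)
          ∘ₗ (TensorProduct.assoc k (base k H C) C H).toLinearMap
          ∘ₗ (TensorProduct.mk k (base k H C ⊗[k] C) H).flip h
          ∘ₗ LinearMap.rTensor C (proj k H C))
        (LinearMap.lTensor C Coalgebra.comul u) := by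
    intro u h
    induction u with
    | zero => simp
    | add a b ha hb => simp only [TensorProduct.add_tmul, map_add, ha, hb]
    | tmul a b => simp [-Submodule.mkQ_apply, h1]
  induction x with
  | zero => simp
  | add a b ha hb => rw [map_add]; exact add_mem ha hb
  | tmul c h =>
    change TensorProduct.assoc k C (base k H C) C
        (LinearMap.rTensor C (LinearMap.lTensor C (proj k H C) ∘ₗ Coalgebra.comul)
          (LinearMap.lTensor C (rightAct k H C)
            (TensorProduct.assoc k C C H (Coalgebra.comul (R := k) c ⊗ₜ h)))) =
      LinearMap.lTensor C (LinearMap.rTensor C (proj k H C) ∘ₗ Coalgebra.comul)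
          (LinearMap.lTensor C (rightAct k H C)
            (TensorProduct.assoc k C C H (Coalgebra.comul (R := k) c ⊗ₜ h)))
    rw [h2, h3, Coalgebra.coassoc_apply]

/-- The canonical map `can : C ⊗ H → C □_D C`, `c ⊗ h ↦ c₁ ⊗ c₂ h`. -/
noncomputable def can [IsModuleCoalgebra k H C] : C ⊗[k] H →ₗ[k] cotensor k H C :=
  (canAux k H C).codRestrict (cotensor k H C) (canAux_mem k H C)

/-- `C(D)_H` is a Hopf Galois coextension. -/
def IsHopfGalois [IsModuleCoalgebra k H C] : Prop := Function.Bijective (can k H C)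

/-- `C^D = {c | c₁ φ(π(c₂)) = c₂ φ(π(c₁)) for all φ in the dual space of D}`. -/
noncomputable def coextensionCenter : Submodule k C :=
  ⨅ φ : Module.Dual k (base k H C), LinearMap.eqLocus
    ((TensorProduct.rid k C).toLinearMap
      ∘ₗ LinearMap.lTensor C (φ ∘ₗ proj k H C) ∘ₗ Coalgebra.comul)
    ((TensorProduct.lid k C).toLinearMap
      ∘ₗ LinearMap.rTensor C (φ ∘ₗ proj k H C) ∘ₗ Coalgebra.comul)

variable {k H C}

/-- A total cointegral is a counital map of right `H`-modules `C → H`. -/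
structure IsTotalCointegral (f : C →ₗ[k] H) : Prop where
  counit_map : ∀ c : C, Coalgebra.counit (R := k) (f c) = Coalgebra.counit (R := k) c
  map_act : ∀ (c : C) (h : H), f (c <• h) = f c * h

/-- `g` is the (two-sided) inverse of `f` for the convolution product
`(f * g)(c) = f(c₁) g(c₂)`, whose unit is `c ↦ ε(c) 1`. -/
def IsConvInverse (f g : C →ₗ[k] H) : Prop :=
  WithConv.toConv f * WithConv.toConv g = 1 ∧ WithConv.toConv g * WithConv.toConv f = 1

/-- The map `C → H ⊗ C`, `c ↦ g(c₃) f(c₁) ⊗ c₂`. -/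
noncomputable def cleftCoaction (f g : C →ₗ[k] H) : C →ₗ[k] H ⊗[k] C :=
  LinearMap.rTensor C (LinearMap.mul' k H)
    ∘ₗ (TensorProduct.comm k C (H ⊗[k] H)).toLinearMap
    ∘ₗ (TensorProduct.assoc k C H H).toLinearMap
    ∘ₗ (TensorProduct.comm k H (C ⊗[k] H)).toLinearMap
    ∘ₗ TensorProduct.map f (LinearMap.lTensor C g)
    ∘ₗ LinearMap.lTensor C Coalgebra.comul
    ∘ₗ Coalgebra.comul

end Coextension

end HopfCoextension

namespace HopfCoextension

section Coextension

open TensorProduct Coalgebra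

set_option linter.unusedSectionVars false

variable {k H C : Type*} [Field k] [Ring H] [HopfAlgebra k H] [AddCommGroup C] [Module k C]
  [Coalgebra k C] [Module Hᵐᵒᵖ C] [IsScalarTower k Hᵐᵒᵖ C]

/-! Write `κ(h ⊗ c) = c₁ ⊗ c₂ h` for the canonical map with its source flipped. The Galois condition
makes `κ` injective with image `C □_D C`. For `c` in `C^D` the flipped coproduct `c₂ ⊗ c₁` lies in
that image (`comulSwap_mem_cotensor`), and cleftness gives the inverse of `can` explicitly, `c ⊗ c'
↦ c₁ ⊗ f⁻¹(c₂) f(c')`. Hence `ρ(c)` is the unique element with `κ(ρ(c)) = c₂ ⊗ c₁`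
(`canSwap_cleftCoaction`), a description free of `f`.

Everything else follows from this equation and the injectivity of `κ`. Since `k` is a field,
tensoring preserves injectivity and kernels, so `ρ(c) ∈ H ⊗ C^D` can be tested after applying `κ`
(`mem_range_of_canSwap_eq`). The module axioms reduce likewise to identities for iterated coproducts
of `c` (`isRightLeftSAYD_of_canSwap_eq`); the antipode cancels in `canSwap_aydTwist`. -/

variable (k C) in
/-- Right multiplication by `h` as a `k`-linear endomorphism of `C`. -/
noncomputable def actBy (h : H) : C →ₗ[k] C :=
  rightAct k H C ∘ₗ (TensorProduct.mk k C H).flip h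

@[simp] lemma actBy_apply (h : H) (c : C) : actBy k C h c = c <• h := rfl

lemma actBy_add (a b : H) : actBy k C (a + b) = actBy k C a + actBy k C b := by
  ext c
  simp [add_smul]

lemma actBy_smul (r : k) (a : H) : actBy k C (r • a) = r • actBy k C a := by
  ext c
  simp

/-! ### The center and its stability under the action -/

/-- `c` lies in the center iff `c₁ ⊗ π(c₂) = c₂ ⊗ π(c₁)`. -/
lemma mem_coextensionCenter_iff (c : C) :
    c ∈ coextensionCenter k H C ↔
      LinearMap.lTensor C (proj k H C) (comul (R := k) c) =
        TensorProduct.comm k _ _ (LinearMap.rTensor C (proj k H C) (comul (R := k) c)) := by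
  have hcomm : ∀ (φ : Module.Dual k (base k H C)) (u : base k H C ⊗[k] C),
      TensorProduct.lid k C (LinearMap.rTensor C φ u) =
      TensorProduct.rid k C (LinearMap.lTensor C φ (TensorProduct.comm k _ _ u)) := by
    intro φ u
    induction u with
    | zero => simp
    | add a b ha hb => simp only [map_add, ha, hb]
    | tmul a b => simp
  -- Functionals on `D` separate points of `C ⊗ D`: the coordinate functionals of a basis of `D`
  -- already do.
  have hsep : ∀ u v : C ⊗[k] base k H C,
      (∀ φ : Module.Dual k (base k H C), TensorProduct.rid k C (LinearMap.lTensor C φ u) =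
        TensorProduct.rid k C (LinearMap.lTensor C φ v)) → u = v := by
    classical
    intro u v huv
    let b := Module.Basis.ofVectorSpace k (base k H C)
    apply (TensorProduct.equivFinsuppOfBasisRight (M := C) b).injective
    ext i
    have hb : ∀ w : C ⊗[k] base k H C, TensorProduct.equivFinsuppOfBasisRight (M := C) b w i =
        TensorProduct.rid k C (LinearMap.lTensor C (b.coord i) w) := by
      intro w
      induction w with
      | zero => simp
      | add a b ha hb => simp only [map_add, Finsupp.add_apply, ha, hb]
      | tmul a d => simp
    rw [hb, hb, huv]
  simp only [coextensionCenter, Submodule.mem_iInf, LinearMap.mem_eqLocus, LinearMap.comp_apply,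
    LinearEquiv.coe_coe, LinearMap.lTensor_comp, LinearMap.rTensor_comp, hcomm]
  exact ⟨fun h => hsep _ _ h, fun h φ => by rw [h]⟩

/-- Since `π(c h) = ε(h) π(c)`, the factor `h₂` in `c₁ h₁ ⊗ π(c₂ h₂)` is absorbed by the counit,
leaving all of `h` on the first leg. -/
lemma lTensor_proj_comul_act [IsModuleCoalgebra k H C] (c : C) (h : H) :
    LinearMap.lTensor C (proj k H C) (comul (R := k) (c <• h)) =
      TensorProduct.map (actBy k C h) (proj k H C) (comul (R := k) c) := by
  have key : ∀ (u : C ⊗[k] C) (v : H ⊗[k] H),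
      LinearMap.lTensor C (proj k H C) (TensorProduct.map (rightAct k H C) (rightAct k H C)
          (TensorProduct.tensorTensorTensorComm k C C H H (u ⊗ₜ v))) =
        TensorProduct.map (rightAct k H C ∘ₗ (TensorProduct.mk k C H).flip
            (TensorProduct.rid k H (LinearMap.lTensor H counit v))) (proj k H C) u := by
    intro u v
    induction u with
    | zero => simp
    | add a b ha hb => simp only [TensorProduct.add_tmul, map_add, ha, hb]
    | tmul a b =>
      induction v with
      | zero => simp
      | add x y hx hy =>
        simp only [TensorProduct.tmul_add, map_add, hx, hy, LinearMap.comp_add,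
          TensorProduct.map_tmul, LinearMap.add_apply, TensorProduct.add_tmul]
      | tmul x y =>
        simp only [TensorProduct.tensorTensorTensorComm_tmul, TensorProduct.map_tmul,
          rightAct_tmul, LinearMap.lTensor_tmul, proj_act, TensorProduct.tmul_smul,
          TensorProduct.rid_tmul, LinearMap.comp_apply, LinearMap.flip_apply,
          TensorProduct.mk_apply, LinearMap.smul_apply, map_smul, TensorProduct.smul_tmul']
        rw [smul_comm]
  rw [IsModuleCoalgebra.comul_act, key]
  simp [actBy]

lemma rTensor_proj_comul_act [IsModuleCoalgebra k H C] (c : C) (h : H) :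
    LinearMap.rTensor C (proj k H C) (comul (R := k) (c <• h)) =
      TensorProduct.map (proj k H C) (actBy k C h) (comul (R := k) c) := by
  have key : ∀ (u : C ⊗[k] C) (v : H ⊗[k] H),
      LinearMap.rTensor C (proj k H C) (TensorProduct.map (rightAct k H C) (rightAct k H C)
          (TensorProduct.tensorTensorTensorComm k C C H H (u ⊗ₜ v))) =
        TensorProduct.map (proj k H C) (rightAct k H C ∘ₗ (TensorProduct.mk k C H).flip
            (TensorProduct.lid k H (LinearMap.rTensor H counit v))) u := by
    intro u v
    induction u with
    | zero => simp
    | add a b ha hb => simp only [TensorProduct.add_tmul, map_add, ha, hb]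
    | tmul a b =>
      induction v with
      | zero => simp
      | add x y hx hy =>
        simp only [TensorProduct.tmul_add, map_add, hx, hy, LinearMap.comp_add,
          TensorProduct.map_tmul, LinearMap.add_apply, TensorProduct.tmul_add]
      | tmul x y =>
        simp only [TensorProduct.tensorTensorTensorComm_tmul, TensorProduct.map_tmul,
          rightAct_tmul, LinearMap.rTensor_tmul, proj_act, TensorProduct.smul_tmul,
          TensorProduct.lid_tmul, LinearMap.comp_apply, LinearMap.flip_apply,
          TensorProduct.mk_apply, LinearMap.smul_apply, map_smul]
  rw [IsModuleCoalgebra.comul_act, key]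
  simp [actBy]

variable (k H C) in
/-- The center `C^D` as a right `H`-submodule of `C`. -/
noncomputable def centerSubmodule [IsModuleCoalgebra k H C] : Submodule Hᵐᵒᵖ C where
  __ := (coextensionCenter k H C).toAddSubmonoid
  smul_mem' := by
    intro a c hc
    obtain ⟨h, rfl⟩ := MulOpposite.op_surjective a
    replace hc := (mem_coextensionCenter_iff c).1 hc
    refine (mem_coextensionCenter_iff (c <• h)).2 ?_
    -- Both sides are now obtained from those of `hc` by letting `h` act on the `C` leg.
    rw [lTensor_proj_comul_act, rTensor_proj_comul_act,
      ← LinearMap.rTensor_comp_lTensor, LinearMap.comp_apply, hc,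
      ← LinearMap.lTensor_comp_rTensor, LinearMap.comp_apply, LinearMap.rTensor,
      TensorProduct.map_comm, LinearMap.lTensor]

/-! ### The canonical map and its inverse on flipped coproducts -/

variable (k H C) in
/-- The map `H ⊗ C → C ⊗ C`, `h ⊗ c ↦ c₁ ⊗ c₂ h`. -/
noncomputable def canSwap : H ⊗[k] C →ₗ[k] C ⊗[k] C :=
  canAux k H C ∘ₗ (TensorProduct.comm k H C).toLinearMap

lemma canAux_tmul (c : C) (h : H) :
    canAux k H C (c ⊗ₜ h) = LinearMap.lTensor C (actBy k C h) (comul (R := k) c) := by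
  simp only [canAux, LinearMap.comp_apply, LinearMap.rTensor_tmul, LinearEquiv.coe_coe]
  induction (comul (R := k) c) with
  | zero => simp
  | add a b ha hb => simp only [TensorProduct.add_tmul, map_add, ha, hb]
  | tmul a b => simp

@[simp] lemma canSwap_tmul (c : C) (h : H) :
    canSwap k H C (h ⊗ₜ c) = LinearMap.lTensor C (actBy k C h) (comul (R := k) c) :=
  canAux_tmul c h

lemma IsHopfGalois.canSwap_injective [IsModuleCoalgebra k H C] (hG : IsHopfGalois k H C) :
    Function.Injective (canSwap k H C) := by
  have : Function.Injective (canAux k H C) := fun x y hxy => hG.1 (Subtype.ext hxy)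
  exact this.comp (TensorProduct.comm k H C).injective

/-- For `c` in the center, `c₂ ⊗ c₁` lies in the cotensor product. -/
lemma comulSwap_mem_cotensor {c : C} (hc : c ∈ coextensionCenter k H C) :
    TensorProduct.comm k C C (comul (R := k) c) ∈ cotensor k H C := by
  rw [mem_coextensionCenter_iff] at hc
  -- `P` is the permutation `(a ⊗ b) ⊗ d ↦ b ⊗ (d ⊗ a)`. Applying `Δ ⊗ id` to `c₁ ⊗ π(c₂) = c₂ ⊗
  -- π(c₁)` and then `P` gives `c₂ ⊗ π(c₃) ⊗ c₁ = c₃ ⊗ π(c₁) ⊗ c₂`, the cotensor condition for `c₂ ⊗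
  -- c₁`.
  let P : (C ⊗[k] C) ⊗[k] base k H C →ₗ[k] C ⊗[k] (base k H C ⊗[k] C) :=
    (TensorProduct.comm k _ _).toLinearMap ∘ₗ (TensorProduct.assoc k _ _ _).symm.toLinearMap
      ∘ₗ (TensorProduct.comm k _ _).toLinearMap
  let Q : C ⊗[k] (C ⊗[k] C) →ₗ[k] C ⊗[k] (base k H C ⊗[k] C) :=
    P ∘ₗ LinearMap.lTensor _ (proj k H C) ∘ₗ (TensorProduct.assoc k _ _ _).symm.toLinearMap
  let Q' : (C ⊗[k] C) ⊗[k] C →ₗ[k] C ⊗[k] (base k H C ⊗[k] C) :=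
    P ∘ₗ LinearMap.lTensor _ (proj k H C) ∘ₗ (TensorProduct.comm k _ _).toLinearMap
      ∘ₗ (TensorProduct.assoc k _ _ _).toLinearMap
  have h1 : ∀ u : C ⊗[k] C, TensorProduct.assoc k C (base k H C) C
      (LinearMap.rTensor C (LinearMap.lTensor C (proj k H C) ∘ₗ comul)
        (TensorProduct.comm k C C u)) = Q (LinearMap.lTensor C comul u) := by
    intro u
    induction u with
    | zero => simp
    | add a b ha hb => simp only [map_add, ha, hb]
    | tmul a b =>
      simp only [TensorProduct.comm_tmul, LinearMap.rTensor_tmul, LinearMap.lTensor_tmul,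
        LinearMap.comp_apply]
      induction (comul (R := k) b) with
      | zero => simp
      | add a b ha hb => simp only [map_add, TensorProduct.add_tmul, TensorProduct.tmul_add, ha, hb]
      | tmul x y => simp [P, Q]
  have h2 : ∀ u : C ⊗[k] C,
      (LinearMap.lTensor C (LinearMap.rTensor C (proj k H C) ∘ₗ comul)
        (TensorProduct.comm k C C u)) = Q' (LinearMap.rTensor C comul u) := by
    intro u
    induction u with
    | zero => simp
    | add a b ha hb => simp only [map_add, ha, hb]
    | tmul a b =>
      simp only [TensorProduct.comm_tmul, LinearMap.rTensor_tmul, LinearMap.lTensor_tmul,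
        LinearMap.comp_apply]
      induction (comul (R := k) a) with
      | zero => simp
      | add a b ha hb => simp only [map_add, TensorProduct.add_tmul, TensorProduct.tmul_add, ha, hb]
      | tmul x y => simp [P, Q']
  have h3 : ∀ u : C ⊗[k] C, P (LinearMap.rTensor _ comul (LinearMap.lTensor C (proj k H C) u)) =
      P (LinearMap.lTensor _ (proj k H C) (LinearMap.rTensor C comul u)) := by
    intro u
    rw [← LinearMap.comp_apply (LinearMap.rTensor _ _), ← LinearMap.comp_apply (LinearMap.lTensor _ _),
      LinearMap.rTensor_comp_lTensor, LinearMap.lTensor_comp_rTensor]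
  have h4 : ∀ u : C ⊗[k] C, P (LinearMap.rTensor _ comul (TensorProduct.comm k _ _
      (LinearMap.rTensor C (proj k H C) u))) =
      P (LinearMap.lTensor _ (proj k H C)
        (TensorProduct.comm k _ _ (LinearMap.lTensor C comul u))) := by
    intro u
    induction u with
    | zero => simp
    | add a b ha hb => simp only [map_add, ha, hb]
    | tmul a b => simp
  rw [cotensor, LinearMap.mem_eqLocus, LinearMap.comp_apply, LinearEquiv.coe_coe, h1, h2]
  simp only [Q, Q', LinearMap.comp_apply, LinearEquiv.coe_coe]
  rw [← Coalgebra.coassoc_apply, LinearEquiv.symm_apply_apply, ← h3, hc, h4,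
    Coalgebra.coassoc_apply]

/-- For `c` in the center, `can` sends the flip of `g(c₃) f(c₁) ⊗ c₂` to `c₂ ⊗ c₁`, because its
inverse is `c ⊗ c' ↦ c₁ ⊗ g(c₂) f(c')`. -/
lemma canSwap_cleftCoaction [IsModuleCoalgebra k H C] (hG : IsHopfGalois k H C)
    {f g : C →ₗ[k] H} (hf : IsTotalCointegral f) (hfg : IsConvInverse f g)
    {c : C} (hc : c ∈ coextensionCenter k H C) :
    canSwap k H C (cleftCoaction f g c) = TensorProduct.comm k C C (comul (R := k) c) := by
  -- `T(c ⊗ c') = c₁ ⊗ g(c₂) f(c')`. By `H`-linearity of `f`, `T(c₁ ⊗ c₂ h) = c₁ ⊗ g(c₂) f(c₃) h = c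
  -- ⊗ h`.
  let T : C ⊗[k] C →ₗ[k] C ⊗[k] H :=
    LinearMap.lTensor C (LinearMap.mul' k H ∘ₗ TensorProduct.map g f)
      ∘ₗ (TensorProduct.assoc k C C C).toLinearMap ∘ₗ LinearMap.rTensor C comul
  have hconv : ∀ c : C, LinearMap.mul' k H (TensorProduct.map g f (comul (R := k) c)) =
      algebraMap k H (counit (R := k) c) := fun c => by
    have := congrArg (fun t => t.ofConv c) hfg.2
    exact this
  have hT : ∀ x, T (canAux k H C x) = x := by
    intro x
    induction x with
    | zero => simp
    | add a b ha hb => simp only [map_add, ha, hb]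
    | tmul c h =>
      have h1 : ∀ u : C ⊗[k] C, T (LinearMap.lTensor C (actBy k C h) u) =
          LinearMap.lTensor C (LinearMap.mulRight k h ∘ₗ LinearMap.mul' k H ∘ₗ TensorProduct.map g f)
            (TensorProduct.assoc k C C C (LinearMap.rTensor C comul u)) := by
        intro u
        induction u with
        | zero => simp
        | add a b ha hb => simp only [map_add, ha, hb]
        | tmul a b =>
          simp only [T, LinearMap.comp_apply, LinearEquiv.coe_coe, LinearMap.lTensor_tmul,
            LinearMap.rTensor_tmul]
          induction (comul (R := k) a) with
          | zero => simp
          | add a b ha hb => simp only [map_add, TensorProduct.add_tmul, ha, hb]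
          | tmul x y => simp [hf.map_act, mul_assoc]
      have h2 : (LinearMap.mulRight k h ∘ₗ LinearMap.mul' k H ∘ₗ TensorProduct.map g f) ∘ₗ comul =
          LinearMap.toSpanSingleton k H h ∘ₗ counit := by
        ext c
        simp [hconv, Algebra.smul_def]
      rw [canAux_tmul, h1, Coalgebra.coassoc_apply, ← LinearMap.comp_apply,
        ← LinearMap.lTensor_comp, h2, LinearMap.lTensor_comp, LinearMap.comp_apply,
        Coalgebra.lTensor_counit_comul]
      simp
  have hTΔ : T (TensorProduct.comm k C C (comul (R := k) c)) =
      TensorProduct.comm k H C (cleftCoaction f g c) := by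
    have h1 : ∀ u : C ⊗[k] C, T (TensorProduct.comm k C C u) = TensorProduct.comm k H C
        ((LinearMap.rTensor C (LinearMap.mul' k H)
          ∘ₗ (TensorProduct.comm k C (H ⊗[k] H)).toLinearMap
          ∘ₗ (TensorProduct.assoc k C H H).toLinearMap
          ∘ₗ (TensorProduct.comm k H (C ⊗[k] H)).toLinearMap
          ∘ₗ TensorProduct.map f (LinearMap.lTensor C g)
          ∘ₗ LinearMap.lTensor C comul) u) := by
      intro u
      induction u with
      | zero => simp
      | add a b ha hb => simp only [map_add, ha, hb]
      | tmul a b =>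
        simp only [T, LinearMap.comp_apply, LinearEquiv.coe_coe, LinearMap.lTensor_tmul,
          LinearMap.rTensor_tmul, TensorProduct.comm_tmul, TensorProduct.map_tmul]
        induction (comul (R := k) b) with
        | zero => simp
        | add a b ha hb => simp only [map_add, TensorProduct.add_tmul, ha, hb]
        | tmul x y => simp
    exact h1 _
  -- `T` is only shown to be a left inverse; surjectivity of `can` onto the cotensor product makes
  -- it a right inverse there.
  obtain ⟨y, hy⟩ := hG.2 ⟨_, comulSwap_mem_cotensor hc⟩
  replace hy : canAux k H C y = TensorProduct.comm k C C (comul (R := k) c) :=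
    congrArg Subtype.val hy
  rw [canSwap, LinearMap.comp_apply, LinearEquiv.coe_coe, ← hTΔ, ← hy, hT]

/-! ### The canonical map with an extra leg, and the values of the coaction -/

variable (k H C) in
/-- The map `H ⊗ (C ⊗ V) → (C ⊗ C) ⊗ V`, `h ⊗ (c ⊗ v) ↦ (c₁ ⊗ c₂ h) ⊗ v`. -/
noncomputable def canSwapTensor (V : Type*) [AddCommGroup V] [Module k V] :
    H ⊗[k] (C ⊗[k] V) →ₗ[k] (C ⊗[k] C) ⊗[k] V :=
  LinearMap.rTensor V (canSwap k H C) ∘ₗ (TensorProduct.assoc k H C V).symm.toLinearMap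

/-- Every `V` is flat over the field `k`. -/
lemma IsHopfGalois.canSwapTensor_injective [IsModuleCoalgebra k H C] (hG : IsHopfGalois k H C)
    (V : Type*) [AddCommGroup V] [Module k V] : Function.Injective (canSwapTensor k H C V) :=
  (Module.Flat.rTensor_preserves_injective_linearMap _ hG.canSwap_injective).comp
    (TensorProduct.assoc k H C V).symm.injective

/-- Both sides send `h ⊗ c` to `(c₂ ⊗ c₃ h) ⊗ p(c₁)`. -/
lemma canSwapTensor_comul_swap {V : Type*} [AddCommGroup V] [Module k V] (p : C →ₗ[k] V)
    (x : H ⊗[k] C) :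
    canSwapTensor k H C V (LinearMap.lTensor H ((TensorProduct.comm k V C).toLinearMap
      ∘ₗ LinearMap.rTensor C p ∘ₗ comul) x) =
    TensorProduct.comm k V (C ⊗[k] C) (TensorProduct.assoc k V C C
      (LinearMap.rTensor C (LinearMap.rTensor C p ∘ₗ comul) (canSwap k H C x))) := by
  induction x with
  | zero => simp
  | add a b ha hb => simp only [map_add, ha, hb]
  | tmul h c =>
    have h1 : ∀ u : C ⊗[k] C, canSwapTensor k H C V (h ⊗ₜ TensorProduct.comm k V C
        (LinearMap.rTensor C p u)) = TensorProduct.comm k V (C ⊗[k] C)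
        (TensorProduct.map p (LinearMap.lTensor C (actBy k C h)) (LinearMap.lTensor C comul u)) := by
      intro u
      induction u with
      | zero => simp
      | add a b ha hb => simp only [map_add, TensorProduct.tmul_add, ha, hb]
      | tmul a b => simp [canSwapTensor]
    have h2 : ∀ u : C ⊗[k] C, TensorProduct.assoc k V C C
        (LinearMap.rTensor C (LinearMap.rTensor C p ∘ₗ comul)
          (LinearMap.lTensor C (actBy k C h) u)) =
        TensorProduct.map p (LinearMap.lTensor C (actBy k C h))
          (TensorProduct.assoc k C C C (LinearMap.rTensor C comul u)) := by
      intro u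
      induction u with
      | zero => simp
      | add a b ha hb => simp only [map_add, ha, hb]
      | tmul a b =>
        simp only [LinearMap.lTensor_tmul, LinearMap.rTensor_tmul, LinearMap.comp_apply]
        induction (comul (R := k) a) with
        | zero => simp
        | add a b ha hb => simp only [map_add, TensorProduct.add_tmul, ha, hb]
        | tmul x y => simp
    simp only [LinearMap.lTensor_tmul, LinearMap.comp_apply, LinearEquiv.coe_coe, canSwap_tmul]
    rw [h1, h2, Coalgebra.coassoc_apply]

/-- Both sides send `h ⊗ c` to `(c₁ ⊗ c₂ h) ⊗ π(c₃)`. -/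
lemma canSwapTensor_comul_proj [IsModuleCoalgebra k H C] (x : H ⊗[k] C) :
    canSwapTensor k H C _ (LinearMap.lTensor H (LinearMap.lTensor C (proj k H C) ∘ₗ comul) x) =
    (TensorProduct.assoc k C C _).symm
      (LinearMap.lTensor C (LinearMap.lTensor C (proj k H C) ∘ₗ comul) (canSwap k H C x)) := by
  induction x with
  | zero => simp
  | add a b ha hb => simp only [map_add, ha, hb]
  | tmul h c =>
    have h1 : ∀ u : C ⊗[k] C, canSwapTensor k H C _ (h ⊗ₜ
        (LinearMap.lTensor C (proj k H C) u)) =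
        TensorProduct.map (LinearMap.lTensor C (actBy k C h)) (proj k H C)
          (LinearMap.rTensor C comul u) := by
      intro u
      induction u with
      | zero => simp
      | add a b ha hb => simp only [map_add, TensorProduct.tmul_add, ha, hb]
      | tmul a b => simp [canSwapTensor]
    have h2 : ∀ u : C ⊗[k] C, (TensorProduct.assoc k C C _).symm
        (LinearMap.lTensor C (LinearMap.lTensor C (proj k H C) ∘ₗ comul)
          (LinearMap.lTensor C (actBy k C h) u)) =
        TensorProduct.map (LinearMap.lTensor C (actBy k C h)) (proj k H C)
          ((TensorProduct.assoc k C C C).symm (LinearMap.lTensor C comul u)) := by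
      intro u
      induction u with
      | zero => simp
      | add a b ha hb => simp only [map_add, ha, hb]
      | tmul a b =>
        simp only [LinearMap.lTensor_tmul, LinearMap.comp_apply, actBy_apply,
          lTensor_proj_comul_act]
        induction (comul (R := k) b) with
        | zero => simp
        | add a b ha hb => simp only [map_add, TensorProduct.tmul_add, ha, hb]
        | tmul x y => simp
    simp only [LinearMap.lTensor_tmul, LinearMap.comp_apply, canSwap_tmul]
    rw [h1, h2, Coalgebra.coassoc_symm_apply]

/-- Any `x` with `canSwap x = c₂ ⊗ c₁` lies in `H ⊗ C^D`. -/
lemma mem_range_of_canSwap_eq [IsModuleCoalgebra k H C] (hG : IsHopfGalois k H C)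
    {x : H ⊗[k] C} {c : C}
    (hx : canSwap k H C x = TensorProduct.comm k C C (comul (R := k) c)) :
    x ∈ LinearMap.range (LinearMap.lTensor H (coextensionCenter k H C).subtype) := by
  -- `C^D` is the kernel of `δ`, so by flatness `H ⊗ C^D` is the kernel of `H ⊗ δ`.
  let δ : C →ₗ[k] C ⊗[k] base k H C := LinearMap.lTensor C (proj k H C) ∘ₗ comul -
    (TensorProduct.comm k (base k H C) C).toLinearMap
      ∘ₗ LinearMap.rTensor C (proj k H C) ∘ₗ comul
  have hex : Function.Exact (coextensionCenter k H C).subtype δ := by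
    intro c
    simp [δ, sub_eq_zero, ← mem_coextensionCenter_iff]
  refine (Module.Flat.lTensor_exact H hex x).1 ?_
  rw [LinearMap.lTensor_sub, LinearMap.sub_apply, sub_eq_zero]
  apply hG.canSwapTensor_injective
  rw [canSwapTensor_comul_proj, canSwapTensor_comul_swap, hx]
  -- `Q((a ⊗ b) ⊗ d) = (d ⊗ a) ⊗ π(b)`. After substituting `c₂ ⊗ c₁` for `κ(x)`, both sides become
  -- `(c₃ ⊗ c₁) ⊗ π(c₂)`, with the two bracketings of the iterated coproduct.
  let Q : (C ⊗[k] C) ⊗[k] C →ₗ[k] (C ⊗[k] C) ⊗[k] base k H C :=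
    LinearMap.lTensor _ (proj k H C) ∘ₗ (TensorProduct.assoc k C C C).symm.toLinearMap
      ∘ₗ (TensorProduct.comm k (C ⊗[k] C) C).toLinearMap
  have h1 : ∀ u : C ⊗[k] C, (TensorProduct.assoc k C C _).symm
      (LinearMap.lTensor C (LinearMap.lTensor C (proj k H C) ∘ₗ comul)
        (TensorProduct.comm k C C u)) = Q (LinearMap.rTensor C comul u) := by
    intro u
    induction u with
    | zero => simp
    | add a b ha hb => simp only [map_add, ha, hb]
    | tmul a b =>
      simp only [TensorProduct.comm_tmul, LinearMap.lTensor_tmul, LinearMap.rTensor_tmul,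
        LinearMap.comp_apply]
      induction (comul (R := k) a) with
      | zero => simp
      | add a b ha hb => simp only [map_add, TensorProduct.add_tmul, TensorProduct.tmul_add, ha, hb]
      | tmul x y => simp [Q]
  have h2 : ∀ u : C ⊗[k] C, TensorProduct.comm k _ (C ⊗[k] C) (TensorProduct.assoc k _ C C
      (LinearMap.rTensor C (LinearMap.rTensor C (proj k H C) ∘ₗ comul)
        (TensorProduct.comm k C C u))) =
      Q ((TensorProduct.assoc k C C C).symm (LinearMap.lTensor C comul u)) := by
    intro u
    induction u with
    | zero => simp
    | add a b ha hb => simp only [map_add, ha, hb]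
    | tmul a b =>
      simp only [TensorProduct.comm_tmul, LinearMap.lTensor_tmul, LinearMap.rTensor_tmul,
        LinearMap.comp_apply]
      induction (comul (R := k) b) with
      | zero => simp
      | add a b ha hb => simp only [map_add, TensorProduct.add_tmul, TensorProduct.tmul_add, ha, hb]
      | tmul x y => simp [Q]
  rw [h1, h2, Coalgebra.coassoc_symm_apply]

/-! ### Compatibility of the canonical map with the coproduct of `H` and the twisted action -/

/-- The map `H ⊗ (H ⊗ C) → (C ⊗ C) ⊗ C`, `a ⊗ (b ⊗ c) ↦ (c₁ ⊗ c₂ a) ⊗ c₃ b`, sends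
`h₁ ⊗ (h₂ ⊗ c)` to `(c₁ ⊗ (c₂ h)₁) ⊗ (c₂ h)₂`. -/
lemma canSwapTensor_lTensor_canSwap_comul [IsModuleCoalgebra k H C] (x : H ⊗[k] C) :
    canSwapTensor k H C C (LinearMap.lTensor H (canSwap k H C)
      (TensorProduct.assoc k H H C (LinearMap.rTensor C comul x))) =
    (TensorProduct.assoc k C C C).symm (LinearMap.lTensor C comul (canSwap k H C x)) := by
  induction x with
  | zero => simp
  | add a b ha hb => simp only [map_add, ha, hb]
  | tmul h c =>
    -- `F(a ⊗ b)` sends `(x ⊗ y) ⊗ z` to `(x ⊗ y a) ⊗ z b`; linearity in `a ⊗ b` allows it to be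
    -- evaluated at `Δ(h)`.
    let F : H ⊗[k] H →ₗ[k] (C ⊗[k] C) ⊗[k] C →ₗ[k] (C ⊗[k] C) ⊗[k] C :=
      TensorProduct.lift (LinearMap.mk₂ k
        (fun a b => TensorProduct.map (LinearMap.lTensor C (actBy k C a)) (actBy k C b))
        (fun a a' b => by rw [actBy_add, LinearMap.lTensor_add, TensorProduct.map_add_left])
        (fun r a b => by rw [actBy_smul, LinearMap.lTensor_smul, TensorProduct.map_smul_left])
        (fun a b b' => by rw [actBy_add, TensorProduct.map_add_right])
        (fun r a b => by rw [actBy_smul, TensorProduct.map_smul_right]))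
    have h1 : ∀ v : H ⊗[k] H, canSwapTensor k H C C (LinearMap.lTensor H (canSwap k H C)
        (TensorProduct.assoc k H H C (v ⊗ₜ c))) = F v (LinearMap.rTensor C comul (comul c)) := by
      intro v
      induction v with
      | zero => simp
      | add a b ha hb => simp only [map_add, TensorProduct.add_tmul, LinearMap.add_apply, ha, hb]
      | tmul a b =>
        simp only [TensorProduct.assoc_tmul, LinearMap.lTensor_tmul, canSwap_tmul]
        induction (comul (R := k) c) with
        | zero => simp
        | add a b ha hb => simp only [map_add, TensorProduct.tmul_add, ha, hb]
        | tmul x y => simp [canSwapTensor, F]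
    have h2 : ∀ u : C ⊗[k] C, (TensorProduct.assoc k C C C).symm
        (LinearMap.lTensor C comul (LinearMap.lTensor C (actBy k C h) u)) =
        F (comul h) ((TensorProduct.assoc k C C C).symm (LinearMap.lTensor C comul u)) := by
      intro u
      induction u with
      | zero => simp
      | add a b ha hb => simp only [map_add, ha, hb]
      | tmul a b =>
        simp only [LinearMap.lTensor_tmul, actBy_apply, IsModuleCoalgebra.comul_act]
        induction (comul (R := k) b) with
        | zero => simp
        | add a b ha hb =>
          simp only [map_add, TensorProduct.add_tmul, TensorProduct.tmul_add, ha, hb]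
        | tmul x y =>
          induction (comul (R := k) h) with
          | zero => simp
          | add a b ha hb =>
            simp only [map_add, TensorProduct.tmul_add, LinearMap.add_apply, ha, hb]
          | tmul p q => simp [F]
    rw [LinearMap.rTensor_tmul, h1, canSwap_tmul, h2, Coalgebra.coassoc_symm_apply]

/-- With `x = a ⊗ c`, both sides are `c₁ h₂ ⊗ c₂ a h₁`. -/
lemma canSwap_aydTwist [IsModuleCoalgebra k H C] (x : H ⊗[k] C) (h : H) :
    canSwap k H C (aydTwist k H C (x ⊗ₜ LinearMap.lTensor H comul (comul (R := k) h))) =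
    TensorProduct.map (rightAct k H C) (rightAct k H C)
      (TensorProduct.tensorTensorTensorComm k C C H H
        (canSwap k H C x ⊗ₜ TensorProduct.comm k H H (comul h))) := by
  induction x with
  | zero => simp
  | add a b ha hb => simp only [map_add, TensorProduct.add_tmul, ha, hb]
  | tmul a c =>
    have h1 : ∀ (u : C ⊗[k] C) (g : H ⊗[k] H) (z b : H),
        LinearMap.lTensor C (actBy k C (HopfAlgebra.antipode k z * b))
          (TensorProduct.map (rightAct k H C) (rightAct k H C)
            (TensorProduct.tensorTensorTensorComm k C C H H (u ⊗ₜ g))) =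
        TensorProduct.map (rightAct k H C) (actBy k C b ∘ₗ rightAct k H C)
          (TensorProduct.tensorTensorTensorComm k C C H H (u ⊗ₜ
            LinearMap.lTensor H (LinearMap.mul' k H ∘ₗ LinearMap.lTensor H (HopfAlgebra.antipode k))
              (TensorProduct.assoc k H H H (g ⊗ₜ z)))) := by
      intro u g z b
      induction u with
      | zero => simp
      | add a b ha hb => simp only [map_add, TensorProduct.add_tmul, ha, hb]
      | tmul p q =>
        induction g with
        | zero => simp
        | add a b ha hb =>
          simp only [map_add, TensorProduct.add_tmul, TensorProduct.tmul_add, ha, hb]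
        | tmul x y => simp [mul_smul]
    have h2 : ∀ (x : H) (w : H ⊗[k] H),
        canSwap k H C (aydTwist k H C ((a ⊗ₜ c) ⊗ₜ (x ⊗ₜ w))) =
        TensorProduct.map (rightAct k H C) (actBy k C (a * x) ∘ₗ rightAct k H C)
          (TensorProduct.tensorTensorTensorComm k C C H H (comul (R := k) c ⊗ₜ
            LinearMap.lTensor H (LinearMap.mul' k H ∘ₗ LinearMap.lTensor H (HopfAlgebra.antipode k))
              (TensorProduct.assoc k H H H (LinearMap.rTensor H comul w)))) := by
      intro x w
      induction w with
      | zero => simp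
      | add a b ha hb => simp only [map_add, TensorProduct.tmul_add, ha, hb]
      | tmul y z =>
        rw [aydTwist_tmul, canSwap_tmul, IsModuleCoalgebra.comul_act, h1, LinearMap.rTensor_tmul]
    -- Antipode cancellation `p₁ ⊗ p₂ S(p₃) = p ⊗ 1`, which reduces `c₁ h₂ ⊗ c₂ h₃ S(h₄) a h₁` to
    -- `c₁ h₂ ⊗ c₂ a h₁`.
    have h3 : ∀ p : H,
        LinearMap.lTensor H (LinearMap.mul' k H ∘ₗ LinearMap.lTensor H (HopfAlgebra.antipode k))
          (TensorProduct.assoc k H H H (LinearMap.rTensor H comul (comul (R := k) p))) =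
        p ⊗ₜ 1 := by
      intro p
      rw [Coalgebra.coassoc_apply, ← LinearMap.comp_apply (LinearMap.lTensor H _),
        ← LinearMap.lTensor_comp, LinearMap.comp_assoc, HopfAlgebra.mul_antipode_lTensor_comul,
        LinearMap.lTensor_comp, LinearMap.comp_apply, Coalgebra.lTensor_counit_comul]
      simp
    induction (comul (R := k) h) with
    | zero => simp
    | add a b ha hb => simp only [map_add, TensorProduct.tmul_add, ha, hb]
    | tmul x p =>
      rw [LinearMap.lTensor_tmul, h2, h3, canSwap_tmul, TensorProduct.comm_tmul]
      induction (comul (R := k) c) with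
      | zero => simp
      | add a b ha hb => simp only [map_add, TensorProduct.add_tmul, ha, hb]
      | tmul q r => simp [mul_smul]

/-- Allows the anti-Yetter–Drinfeld identity on a submodule to be checked in `H ⊗ C`, where `κ` is
defined. -/
lemma lTensor_aydTwist (M : Submodule Hᵐᵒᵖ C) (x : H ⊗[k] M) (w : H ⊗[k] (H ⊗[k] H)) :
    LinearMap.lTensor H (M.subtype.restrictScalars k) (aydTwist k H M (x ⊗ₜ w)) =
      aydTwist k H C (LinearMap.lTensor H (M.subtype.restrictScalars k) x ⊗ₜ w) := by
  induction x with
  | zero => simp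
  | add a b ha hb => simp only [map_add, TensorProduct.add_tmul, ha, hb]
  | tmul a m =>
    induction w with
    | zero => simp
    | add a b ha hb => simp only [map_add, TensorProduct.tmul_add, ha, hb]
    | tmul x w =>
      induction w with
      | zero => simp
      | add a b ha hb => simp only [map_add, TensorProduct.tmul_add, ha, hb]
      | tmul y z => simp

/-! ### The stable anti-Yetter–Drinfeld axioms -/

/-- A coaction on the center with `canSwap (ρ c) = c₂ ⊗ c₁` is stable anti-Yetter-Drinfeld. -/
lemma isRightLeftSAYD_of_canSwap_eq [IsModuleCoalgebra k H C] (hG : IsHopfGalois k H C)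
    (M : Submodule Hᵐᵒᵖ C) (ρ : M →ₗ[k] H ⊗[k] M)
    (hρ : ∀ c : M, canSwap k H C (LinearMap.lTensor H (M.subtype.restrictScalars k) (ρ c)) =
      TensorProduct.comm k C C (comul (R := k) (c : C))) : IsRightLeftSAYD ρ := by
  set ι : M →ₗ[k] C := M.subtype.restrictScalars k with hι
  have hιinj : Function.Injective ι := M.subtype_injective
  have hιH : Function.Injective (LinearMap.lTensor H ι) :=
    Module.Flat.lTensor_preserves_injective_linearMap _ hιinj
  refine ⟨?_, ?_, ?_, ?_⟩
  -- Coassociativity: under the composite injection `H ⊗ (H ⊗ M) → (C ⊗ C) ⊗ C` both sides become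
  -- `(c₃ ⊗ c₁) ⊗ c₂`.
  · ext1 c
    apply Module.Flat.lTensor_preserves_injective_linearMap (M := H) _ hιH
    apply Module.Flat.lTensor_preserves_injective_linearMap (M := H) _ hG.canSwap_injective
    apply hG.canSwapTensor_injective
    have h1 : ∀ x : H ⊗[k] M, LinearMap.lTensor H (LinearMap.lTensor H ι)
        (TensorProduct.assoc k H H M (LinearMap.rTensor M comul x)) =
        TensorProduct.assoc k H H C (LinearMap.rTensor C comul (LinearMap.lTensor H ι x)) := by
      intro x
      induction x with
      | zero => simp
      | add a b ha hb => simp only [map_add, ha, hb]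
      | tmul a m =>
        simp only [LinearMap.rTensor_tmul, LinearMap.lTensor_tmul]
        induction (comul (R := k) a) with
        | zero => simp
        | add a b ha hb => simp only [map_add, TensorProduct.add_tmul, ha, hb]
        | tmul x y => simp
    -- The identity map is inserted to match `canSwapTensor_comul_swap` with `p = id`.
    have h2 : ∀ x : H ⊗[k] M, LinearMap.lTensor H (canSwap k H C)
        (LinearMap.lTensor H (LinearMap.lTensor H ι) (LinearMap.lTensor H ρ x)) =
        LinearMap.lTensor H ((TensorProduct.comm k C C).toLinearMap
          ∘ₗ LinearMap.rTensor C LinearMap.id ∘ₗ comul) (LinearMap.lTensor H ι x) := by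
      intro x
      simp only [← LinearMap.comp_apply, ← LinearMap.lTensor_comp]
      congr 2
      ext m
      rw [LinearMap.rTensor_id]
      exact hρ m
    have h3 : ∀ u : C ⊗[k] C, (TensorProduct.assoc k C C C).symm (LinearMap.lTensor C comul
        (TensorProduct.comm k C C u)) = (TensorProduct.assoc k C C C).symm
        (TensorProduct.comm k (C ⊗[k] C) C (LinearMap.rTensor C comul u)) := by
      intro u
      induction u with
      | zero => simp
      | add a b ha hb => simp only [map_add, ha, hb]
      | tmul a b => simp
    have h4 : ∀ u : C ⊗[k] C, TensorProduct.comm k C (C ⊗[k] C) (TensorProduct.assoc k C C C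
        (LinearMap.rTensor C comul (TensorProduct.comm k C C u))) =
        (TensorProduct.assoc k C C C).symm (TensorProduct.comm k (C ⊗[k] C) C
          ((TensorProduct.assoc k C C C).symm (LinearMap.lTensor C comul u))) := by
      intro u
      induction u with
      | zero => simp
      | add a b ha hb => simp only [map_add, ha, hb]
      | tmul a b =>
        simp only [LinearMap.rTensor_tmul, LinearMap.lTensor_tmul, TensorProduct.comm_tmul]
        induction (comul (R := k) b) with
        | zero => simp
        | add a b ha hb =>
          simp only [map_add, TensorProduct.add_tmul, TensorProduct.tmul_add, ha, hb]
        | tmul x y => simp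
    simp only [LinearMap.comp_apply, LinearEquiv.coe_coe]
    rw [h1, h2, canSwapTensor_lTensor_canSwap_comul, canSwapTensor_comul_swap, hρ,
      LinearMap.rTensor_id, LinearMap.id_comp, h3, h4, Coalgebra.coassoc_symm_apply]
  -- Counit: `(id ⊗ ε) κ(h ⊗ c) = ε(h) c`, and `id ⊗ ε` sends `m₂ ⊗ m₁` to `m`.
  · intro m
    apply hιinj
    have h1 : ∀ x : H ⊗[k] C, TensorProduct.rid k C (LinearMap.lTensor C counit
        (canSwap k H C x)) = TensorProduct.lid k C (LinearMap.rTensor C counit x) := by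
      intro x
      induction x with
      | zero => simp
      | add a b ha hb => simp only [map_add, ha, hb]
      | tmul h c =>
        have : counit ∘ₗ actBy k C h = counit (R := k) h • counit (R := k) (A := C) := by
          ext c
          simp [IsModuleCoalgebra.counit_act, mul_comm]
        rw [canSwap_tmul, ← LinearMap.comp_apply (LinearMap.lTensor C _), ← LinearMap.lTensor_comp,
          this, LinearMap.lTensor_smul, LinearMap.smul_apply, Coalgebra.lTensor_counit_comul]
        simp
    have h2 : ∀ x : H ⊗[k] M, ι (TensorProduct.lid k M (LinearMap.rTensor M counit x)) =
        TensorProduct.lid k C (LinearMap.rTensor C counit (LinearMap.lTensor H ι x)) := by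
      intro x
      induction x with
      | zero => simp
      | add a b ha hb => simp only [map_add, ha, hb]
      | tmul h c => simp
    rw [h2, ← h1, hρ]
    have h3 : ∀ u : C ⊗[k] C, LinearMap.lTensor C (counit (R := k))
        (TensorProduct.comm k C C u) =
        TensorProduct.comm k k C (LinearMap.rTensor C counit u) := by
      intro u
      induction u with
      | zero => simp
      | add a b ha hb => simp only [map_add, ha, hb]
      | tmul a b => simp
    rw [h3, Coalgebra.rTensor_counit_comul]
    simp [hι]
  -- Anti-Yetter–Drinfeld condition: `κ` sends both sides to `m₂ h₂ ⊗ m₁ h₁`, the flipped coproduct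
  -- of `m h`.
  · intro m h
    apply hιH
    apply hG.canSwap_injective
    rw [hρ, hι, lTensor_aydTwist, ← hι, canSwap_aydTwist, hρ]
    have h1 : ∀ (u : C ⊗[k] C) (v : H ⊗[k] H), TensorProduct.comm k C C
        (TensorProduct.map (rightAct k H C) (rightAct k H C)
          (TensorProduct.tensorTensorTensorComm k C C H H (u ⊗ₜ v))) =
        TensorProduct.map (rightAct k H C) (rightAct k H C)
          (TensorProduct.tensorTensorTensorComm k C C H H
            (TensorProduct.comm k C C u ⊗ₜ TensorProduct.comm k H H v)) := by
      intro u v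
      induction u with
      | zero => simp
      | add a b ha hb => simp only [map_add, TensorProduct.add_tmul, ha, hb]
      | tmul a b =>
        induction v with
        | zero => simp
        | add a b ha hb => simp only [map_add, TensorProduct.tmul_add, ha, hb]
        | tmul x y => simp
    rw [← h1, ← IsModuleCoalgebra.comul_act]
    rfl
  -- Stability: `(ε ⊗ id) κ(h ⊗ c) = c h`, and `ε ⊗ id` sends `m₂ ⊗ m₁` to `m`.
  · intro m
    apply hιinj
    have h1 : ∀ x : H ⊗[k] C, TensorProduct.lid k C (LinearMap.rTensor C counit
        (canSwap k H C x)) = rightAct k H C (TensorProduct.comm k H C x) := by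
      intro x
      induction x with
      | zero => simp
      | add a b ha hb => simp only [map_add, ha, hb]
      | tmul h c =>
        rw [canSwap_tmul, ← LinearMap.comp_apply (LinearMap.rTensor C _),
          LinearMap.rTensor_comp_lTensor, ← LinearMap.lTensor_comp_rTensor, LinearMap.comp_apply,
          Coalgebra.rTensor_counit_comul]
        simp
    have h2 : ∀ x : H ⊗[k] M, ι (rightAct k H M (TensorProduct.comm k H M x)) =
        rightAct k H C (TensorProduct.comm k H C (LinearMap.lTensor H ι x)) := by
      intro x
      induction x with
      | zero => simp
      | add a b ha hb => simp only [map_add, ha, hb]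
      | tmul h c => simp [hι]
    rw [h2, ← h1, hρ]
    have h3 : ∀ u : C ⊗[k] C, LinearMap.rTensor C (counit (R := k))
        (TensorProduct.comm k C C u) =
        TensorProduct.comm k C k (LinearMap.lTensor C counit u) := by
      intro u
      induction u with
      | zero => simp
      | add a b ha hb => simp only [map_add, ha, hb]
      | tmul a b => simp
    rw [h3, Coalgebra.lTensor_counit_comul]
    simp [hι]

end Coextension
end HopfCoextension

/-! ### The main theorem -/

theorem proposition3p28 {k H C : Type*} [Field k] [Ring H] [HopfAlgebra k H]
    [AddCommGroup C] [Module k C] [Coalgebra k C]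
    [Module Hᵐᵒᵖ C] [IsScalarTower k Hᵐᵒᵖ C] [HopfCoextension.IsModuleCoalgebra k H C]
    (hGalois : HopfCoextension.IsHopfGalois k H C)
    (f fInv : C →ₗ[k] H) (hf : HopfCoextension.IsTotalCointegral f)
    (hfInv : HopfCoextension.IsConvInverse f fInv) :
    ∃ M : Submodule Hᵐᵒᵖ C,
      M.restrictScalars k = HopfCoextension.coextensionCenter k H C ∧
      ∃ ρ : M →ₗ[k] H ⊗[k] M,
        (∀ c : M, LinearMap.lTensor H (M.subtype.restrictScalars k) (ρ c) =
          HopfCoextension.cleftCoaction f fInv (c : C)) ∧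
        HopfCoextension.IsRightLeftSAYD ρ := by
  let M := HopfCoextension.centerSubmodule k H C
  let ι : M →ₗ[k] C := M.subtype.restrictScalars k
  have hι : Function.Injective (LinearMap.lTensor H ι) :=
    Module.Flat.lTensor_preserves_injective_linearMap _ M.subtype_injective
  let R : M →ₗ[k] H ⊗[k] C := HopfCoextension.cleftCoaction f fInv ∘ₗ ι
  have hK : ∀ c : M, HopfCoextension.canSwap k H C (R c) =
      TensorProduct.comm k C C (Coalgebra.comul (R := k) (c : C)) := fun c =>
    HopfCoextension.canSwap_cleftCoaction hGalois hf hfInv c.2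
  -- `e` identifies `H ⊗ C^D` with its image in `H ⊗ C`; `ρ` is the formula `R` corestricted to that
  -- image and pulled back.
  let e := LinearEquiv.ofInjective (LinearMap.lTensor H ι) hι
  let ρ : M →ₗ[k] H ⊗[k] M := e.symm.toLinearMap ∘ₗ R.codRestrict _ fun c =>
    HopfCoextension.mem_range_of_canSwap_eq hGalois (hK c)
  have hρ : ∀ c : M, LinearMap.lTensor H ι (ρ c) = R c := fun c =>
    congrArg Subtype.val (e.apply_symm_apply _)
  refine ⟨M, rfl, ρ, hρ, HopfCoextension.isRightLeftSAYD_of_canSwap_eq hGalois M ρ fun c => ?_⟩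
  exact (congrArg _ (hρ c)).trans (hK c)
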